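/- Let $\lambda>0$ and let $G$ be a probability distribution on $[0,\infty)$. Let $I_1,I_2,\dots$ be exponentially distributed with mean $1/\lambda$ and $S_1,S_2,\dots$ distributed according to $G$, all these random variables being independent; put $T_0=0$ and $T_n=I_1+\dots+I_n$. For $x\in[0,1]$ let $V^x=(V^x_t)_{t\ge 0}$ be the workload process of the M/G/1 queue with capacity $1$ and truncated service (Model 1): $V^x_0=x$, and for $n\ge 1$ $$V^x_t=\max\bigl[V^x_{T_{n-1}}-(t-T_{n-1}),0\bigr]\quad (T_{n-1}\le t<T_n),\qquad V^x_{T_n}=\min\bigl[V^x_{T_n-}+S_n,\,1\bigr].$$ A probability measure $\pi$ on $[0,1]$ is called invariant (stationary) if $\int \mathbb P(V^x_t\in A)\,\pi(dx)=\pi(A)$ for all $t\ge 0$ and all Borel sets $A$. Let $\bar G(x)=1-G(x)=G((x,\infty))$ for $x\ge 0$, and let $\bar G^{*i}$ be its convolution powers on the half line: $\bar G^{*1}=\bar G$ and $\bar G^{*(i+1)}(x)=\int_0^x\bar G(x-y)\,\bar G^{*i}(y)\,dy$. **Theorem 1.** There is exactly one invariant distribution $\pi$. The series $\sum_{i\ge1}\lambda^i\bar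 G^{*i}(x)$ and $\sum_{i\ge1}\lambda^i\int_0^x\bar G^{*i}(y)\,dy$ converge for all $x\in[0,1]$. On $(0,1]$ the distribution $\pi$ has the density (with respect to Lebesgue measure) $$\bar\pi(x)=\frac{1}{1+\sum_{i=1}^\infty\lambda^i\int_0^1\bar G^{*i}(y)\,dy}\;\sum_{i=1}^\infty\lambda^i\,\bar G^{*i}(x),$$ and its distribution function $\pi(x)=\pi([0,x])$ is $$\pi(x)=\frac{1+\sum_{i=1}^\infty\lambda^i\int_0^x\bar G^{*i}(y)\,dy}{1+\sum_{i=1}^\infty\lambda^i\int_0^1\bar G^{*i}(y)\,dy},\qquad 0\le x\le 1.$$ In particular $\pi$ has an atom at $0$ of mass $\pi(\{0\})=\bigl(1+\sum_{i\ge1}\lambda^i\int_0^1\bar G^{*i}(y)\,dy\bigr)^{-1}>0$. -/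

import Mathlib

namespace TruncatedQueue

open MeasureTheory ProbabilityTheory Set

noncomputable section

/-- The random input of the M/G/1 queue with arrival rate `lam` and service distribution `G`:
`I n` is the time between the `n`-th and the `(n+1)`-st arrival (the `0`-th "arrival" being time
`0`), and `S n` is the service requirement of the `(n+1)`-st customer. -/
structure IsInput {Ω : Type*} [MeasurableSpace Ω] (P : Measure Ω) (lam : ℝ) (G : Measure ℝ)
    (I S : ℕ → Ω → ℝ) : Prop where
  measurable_I : ∀ n, Measurable (I n)
  measurable_S : ∀ n, Measurable (S n)
  law_I : ∀ n, P.map (I n) = expMeasure lam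
  law_S : ∀ n, P.map (S n) = G
  /-- All the variables `I 0, I 1, …, S 0, S 1, …` together are mutually independent. -/
  indep : iIndepFun (Sum.elim I S) P

/-- The arrival times `T₀ = 0`, `Tₙ = I₁ + ⋯ + Iₙ` along one path `i` of inter-arrival times. -/
def arrivalTime (i : ℕ → ℝ) (n : ℕ) : ℝ := ∑ k ∈ Finset.range n, i k

/-- The workload right at time `Tₙ`, started in `x`. Between arrivals it decreases at rate one
until it reaches `0`; an arrival adds its service requirement, truncated at the capacity `1`. -/
def workloadAtArrival (i s : ℕ → ℝ) (x : ℝ) : ℕ → ℝ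
  | 0 => x
  | n + 1 => min (max (workloadAtArrival i s x n - i n) 0 + s n) 1

/-- The number of arrivals in `(0, t]`, i.e. the `n` with `Tₙ ≤ t < Tₙ₊₁`
(almost surely `T₀ < T₁ < ⋯` tends to infinity, so that this `n` exists). -/
def arrivalCount (i : ℕ → ℝ) (t : ℝ) : ℕ := sSup {n : ℕ | arrivalTime i n ≤ t}

/-- The workload at time `t ≥ 0` of the queue with truncated service, started in `x`. -/
def workload (i s : ℕ → ℝ) (x t : ℝ) : ℝ :=
  max (workloadAtArrival i s x (arrivalCount i t) - (t - arrivalTime i (arrivalCount i t))) 0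

/-- The law of the workload at time `t` when it starts in `x`: `A ↦ ℙ(Vₜˣ ∈ A)`. -/
def transition {Ω : Type*} [MeasurableSpace Ω] (P : Measure Ω) (I S : ℕ → Ω → ℝ)
    (t x : ℝ) (A : Set ℝ) : ENNReal :=
  P {ω | workload (fun n => I n ω) (fun n => S n ω) x t ∈ A}

/-- `π` is an invariant (stationary) probability distribution, on the state space `[0, 1]`, of the
workload process. -/
structure IsInvariantDistribution {Ω : Type*} [MeasurableSpace Ω] (P : Measure Ω)
    (I S : ℕ → Ω → ℝ) (π : Measure ℝ) : Prop where
  isProbabilityMeasure : IsProbabilityMeasure π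
  supported : π (Icc 0 1)ᶜ = 0
  invariant : ∀ t : ℝ, 0 ≤ t → ∀ A : Set ℝ, MeasurableSet A →
    ∫⁻ x, transition P I S t x A ∂π = π A

/-- The tail `Ḡ(x) = 1 - G(x) = G((x, ∞))` of the distribution `G`. -/
def tail (G : Measure ℝ) (x : ℝ) : ℝ := 1 - cdf G x

/-- Convolution powers on the half line: `convPow f n` is `f^{*(n+1)}`, where
`(f * g)(x) = ∫₀ˣ f(x - y) g(y) dy`. -/
def convPow (f : ℝ → ℝ) : ℕ → ℝ → ℝ
  | 0 => f
  | n + 1 => fun x => ∫ y in (0 : ℝ)..x, f (x - y) * convPow f n y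

/-- `∑_{i ≥ 1} λⁱ Ḡ^{*i}(x)`. -/
def densitySeries (lam : ℝ) (G : Measure ℝ) (x : ℝ) : ℝ :=
  ∑' n : ℕ, lam ^ (n + 1) * convPow (tail G) n x

/-- `∑_{i ≥ 1} λⁱ ∫₀ˣ Ḡ^{*i}(y) dy`. -/
def integralSeries (lam : ℝ) (G : Measure ℝ) (x : ℝ) : ℝ :=
  ∑' n : ℕ, lam ^ (n + 1) * ∫ y in (0 : ℝ)..x, convPow (tail G) n y

end

end TruncatedQueue

/-!
Up to normalization the stationary distribution has an atom of mass `1` at `0` and the density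
`u = densitySeries lam G` on `(0, 1]`. It is found by equating, for each level `w < 1`, the rate
`u w` at which the workload crosses `w` downwards with the rate `λ ∫ tail G (w - v) ∂ν` at which
arrivals carry it over `w`. This is the Volterra equation `u = λ tail G + λ (tail G * u)`, whose
solution is the series. Integrating by parts against `e^{-λs}` turns the level crossing identity
into the balance equation obtained by conditioning on the last arrival before time `t`. The renewal
equation of the process conditions on the first arrival after time `0` instead; comparing the two
gives invariance.

Uniqueness is a coupling argument. A gap of length at least `1` between two arrivals empties the
queue whatever it started from, and almost surely such a gap occurs, so that the laws of the
workload started from any two states merge.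
-/

namespace TruncatedQueue

open MeasureTheory ProbabilityTheory Set Filter Topology
open scoped ENNReal Interval

/-! ### Convolution powers and the Volterra resolvent -/

theorem measurable_intervalIntegral_convolution {f g : ℝ → ℝ} (hf : Measurable f)
    (hg : Measurable g) : Measurable fun x : ℝ => ∫ y in (0 : ℝ)..x, f (x - y) * g y := by
  have hrescale : (fun x : ℝ => ∫ y in (0 : ℝ)..x, f (x - y) * g y) =
      fun x => x * ∫ u in Ioc (0 : ℝ) 1, f (x - x * u) * g (x * u) := by
    ext x
    rw [← intervalIntegral.integral_of_le zero_le_one,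
      intervalIntegral.mul_integral_comp_mul_left (f := fun y => f (x - y) * g y), mul_zero,
      mul_one]
  have hint : Measurable fun p : ℝ × ℝ => f (p.1 - p.1 * p.2) * g (p.1 * p.2) := by fun_prop
  rw [hrescale]
  exact measurable_id.mul hint.stronglyMeasurable.integral_prod_right'.measurable

theorem measurable_convPow {f : ℝ → ℝ} (hf : Measurable f) (n : ℕ) : Measurable (convPow f n) := by
  induction n with
  | zero => exact hf
  | succ n ih => exact measurable_intervalIntegral_convolution hf ih

theorem convPow_nonneg {f : ℝ → ℝ} (hf : ∀ x, 0 ≤ f x) (n : ℕ) {x : ℝ} (hx : 0 ≤ x) :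
    0 ≤ convPow f n x := by
  induction n generalizing x with
  | zero => exact hf x
  | succ n ih =>
    exact intervalIntegral.integral_nonneg hx fun y hy => mul_nonneg (hf _) (ih hy.1)

theorem abs_le_of_mem_uIoc_zero {x y : ℝ} (hy : y ∈ Ι 0 x) : |y| ≤ |x| := by
  simpa using abs_sub_left_of_mem_uIcc (uIoc_subset_uIcc hy)

theorem intervalIntegrable_of_abs_le {g : ℝ → ℝ} (hg : Measurable g) {a b C : ℝ}
    (hC : ∀ x ∈ Ι a b, |g x| ≤ C) : IntervalIntegrable g volume a b := by
  rw [intervalIntegrable_iff]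
  exact Measure.integrableOn_of_bounded (by simp [uIoc]) hg.aestronglyMeasurable
    (ae_restrict_of_forall_mem measurableSet_uIoc hC)

/-- The resolvent `∑_{i ≥ 1} λⁱ f^{*i}` of the Volterra equation `u = λ f + λ (f * u)`; for
`f = tail G` it is `densitySeries lam G`. -/
noncomputable def volterraResolvent (lam : ℝ) (f : ℝ → ℝ) (x : ℝ) : ℝ :=
  ∑' n : ℕ, lam ^ (n + 1) * convPow f n x

section bounded

variable {f : ℝ → ℝ} {C : ℝ}

theorem abs_convPow_le (hf : ∀ x, |f x| ≤ C) (n : ℕ) (x : ℝ) :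
    |convPow f n x| ≤ C ^ (n + 1) * (|x| ^ n / n.factorial) := by
  have hC : 0 ≤ C := (abs_nonneg _).trans (hf 0)
  induction n generalizing x with
  | zero => simpa [convPow] using hf x
  | succ n ih =>
    have hbound : ∀ y, |f (x - y) * convPow f n y| ≤ C ^ (n + 2) * (|y| ^ n / n.factorial) :=
      fun y => by
        rw [abs_mul, pow_succ' C, mul_assoc]
        exact mul_le_mul (hf _) (ih y) (abs_nonneg _) hC
    have hint : IntegrableOn (fun y : ℝ => C ^ (n + 2) * (|y| ^ n / n.factorial)) (Ι 0 x) :=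
      intervalIntegrable_iff.1 ((by fun_prop : Continuous _).intervalIntegrable _ _)
    calc |convPow f (n + 1) x|
        ≤ ∫ y in Ι 0 x, |f (x - y) * convPow f n y| :=
          intervalIntegral.norm_integral_le_integral_norm_uIoc (f := fun y => f (x - y) * _)
      _ ≤ ∫ y in Ι 0 x, C ^ (n + 2) * (|y| ^ n / n.factorial) :=
          integral_mono_of_nonneg (.of_forall fun _ => abs_nonneg _) hint (.of_forall hbound)
      _ = C ^ (n + 2) * (|x| ^ (n + 1) / (n + 1).factorial) := by
          have hpow := integral_pow_abs_sub_uIoc (a := 0) (b := x) (n := n)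
          simp only [sub_zero] at hpow
          rw [integral_const_mul, integral_div, hpow, div_div, Nat.factorial_succ, Nat.cast_mul,
            Nat.cast_add_one]

theorem intervalIntegrable_convPow (hm : Measurable f) (hf : ∀ x, |f x| ≤ C) (n : ℕ) (x : ℝ) :
    IntervalIntegrable (convPow f n) volume 0 x := by
  have hC : 0 ≤ C := (abs_nonneg _).trans (hf 0)
  refine intervalIntegrable_of_abs_le (measurable_convPow hm n)
    (C := C ^ (n + 1) * (|x| ^ n / n.factorial)) fun y hy => (abs_convPow_le hf n y).trans ?_
  have hpow : |y| ^ n ≤ |x| ^ n := pow_le_pow_left₀ (abs_nonneg y) (abs_le_of_mem_uIoc_zero hy) n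
  gcongr

theorem abs_pow_mul_convPow_le (hf : ∀ x, |f x| ≤ C) (lam : ℝ) (n : ℕ) {x b : ℝ} (hx : |x| ≤ b) :
    |lam ^ (n + 1) * convPow f n x| ≤ |lam| * C * ((|lam| * C * b) ^ n / n.factorial) := by
  have hC : 0 ≤ C := (abs_nonneg _).trans (hf 0)
  calc |lam ^ (n + 1) * convPow f n x|
      ≤ |lam| ^ (n + 1) * (C ^ (n + 1) * (b ^ n / n.factorial)) := by
        rw [abs_mul, abs_pow]
        gcongr
        exact (abs_convPow_le hf n x).trans (by gcongr)
    _ = _ := by ring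

theorem summable_const_mul_pow_div_factorial (c b : ℝ) :
    Summable fun n : ℕ => c * (b ^ n / n.factorial) :=
  (Real.summable_pow_div_factorial b).mul_left c

theorem hasSum_volterraResolvent (hf : ∀ x, |f x| ≤ C) (lam x : ℝ) :
    HasSum (fun n : ℕ => lam ^ (n + 1) * convPow f n x) (volterraResolvent lam f x) :=
  (Summable.of_norm_bounded (summable_const_mul_pow_div_factorial _ _)
    fun n => abs_pow_mul_convPow_le hf lam n le_rfl).hasSum

theorem measurable_volterraResolvent (hm : Measurable f) (hf : ∀ x, |f x| ≤ C) (lam : ℝ) :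
    Measurable (volterraResolvent lam f) :=
  measurable_of_tendsto_metrizable
    (fun N => Finset.measurable_fun_sum (Finset.range N)
      fun n _ => (measurable_convPow hm n).const_mul (lam ^ (n + 1)))
    (tendsto_pi_nhds.2 fun x => (hasSum_volterraResolvent hf lam x).tendsto_sum_nat)

theorem intervalIntegrable_volterraResolvent (hm : Measurable f) (hf : ∀ x, |f x| ≤ C)
    (lam x : ℝ) : IntervalIntegrable (volterraResolvent lam f) volume 0 x :=
  intervalIntegrable_of_abs_le (measurable_volterraResolvent hm hf lam)
    (C := ∑' n : ℕ, |lam| * C * ((|lam| * C * |x|) ^ n / n.factorial)) fun _ hy =>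
      tsum_of_norm_bounded (f := fun n => lam ^ (n + 1) * convPow f n _)
        (summable_const_mul_pow_div_factorial _ _).hasSum
        fun n => abs_pow_mul_convPow_le hf lam n (abs_le_of_mem_uIoc_zero hy)

theorem hasSum_integral_mul_convPow (hm : Measurable f) (hf : ∀ x, |f x| ≤ C) (lam : ℝ) {x : ℝ}
    {k : ℝ → ℝ} (hk : IntervalIntegrable k volume 0 x) :
    HasSum (fun n : ℕ => lam ^ (n + 1) * ∫ y in (0 : ℝ)..x, k y * convPow f n y)
      (∫ y in (0 : ℝ)..x, k y * volterraResolvent lam f y) := by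
  simp_rw [← intervalIntegral.integral_const_mul, mul_left_comm _ (k _)]
  have hsum := summable_const_mul_pow_div_factorial (|lam| * C) (|lam| * C * |x|)
  refine intervalIntegral.hasSum_integral_of_dominated_convergence
    (fun n y => |k y| * (|lam| * C * ((|lam| * C * |x|) ^ n / n.factorial)))
    (fun n => (intervalIntegrable_iff.1 hk).aestronglyMeasurable.mul
      ((measurable_convPow hm n).const_mul _).aestronglyMeasurable)
    (fun n => .of_forall fun y hy => ?_) (.of_forall fun y _ => hsum.mul_left _) ?_
    (.of_forall fun y _ => (hasSum_volterraResolvent hf lam y).mul_left _)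
  · rw [norm_mul]
    exact mul_le_mul_of_nonneg_left
      (abs_pow_mul_convPow_le hf lam n (abs_le_of_mem_uIoc_zero hy)) (norm_nonneg _)
  · simp_rw [tsum_mul_left]
    exact hk.abs.mul_const _

theorem volterraResolvent_eq (hm : Measurable f) (hf : ∀ x, |f x| ≤ C) (lam x : ℝ) :
    volterraResolvent lam f x =
      lam * f x + lam * ∫ y in (0 : ℝ)..x, f (x - y) * volterraResolvent lam f y := by
  have hk : IntervalIntegrable (fun y => f (x - y)) volume 0 x :=
    intervalIntegrable_of_abs_le (hm.comp (measurable_const.sub measurable_id)) fun _ _ => hf _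
  rw [volterraResolvent, (hasSum_volterraResolvent hf lam x).summable.tsum_eq_zero_add,
    ← (hasSum_integral_mul_convPow hm hf lam hk).tsum_eq, ← tsum_mul_left]
  simp only [zero_add, pow_one, convPow, pow_succ' lam (_ + 1), mul_assoc]

end bounded

theorem volterraResolvent_nonneg {f : ℝ → ℝ} (hf : ∀ x, 0 ≤ f x) {lam : ℝ} (hlam : 0 ≤ lam)
    {x : ℝ} (hx : 0 ≤ x) : 0 ≤ volterraResolvent lam f x :=
  tsum_nonneg fun n => mul_nonneg (by positivity) (convPow_nonneg hf n hx)

/-! ### The density series of the queue -/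

theorem tail_nonneg (G : Measure ℝ) (x : ℝ) : 0 ≤ tail G x := sub_nonneg.2 (cdf_le_one G x)

theorem abs_tail_le_one (G : Measure ℝ) (x : ℝ) : |tail G x| ≤ 1 :=
  abs_le.2 ⟨by linarith [tail_nonneg G x], sub_le_self _ (cdf_nonneg G x)⟩

theorem measurable_tail (G : Measure ℝ) : Measurable (tail G) :=
  measurable_const.sub (monotone_cdf G).measurable

theorem measurable_densitySeries (lam : ℝ) (G : Measure ℝ) : Measurable (densitySeries lam G) :=
  measurable_volterraResolvent (measurable_tail G) (abs_tail_le_one G) lam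

theorem intervalIntegrable_densitySeries (lam : ℝ) (G : Measure ℝ) (x : ℝ) :
    IntervalIntegrable (densitySeries lam G) volume 0 x :=
  intervalIntegrable_volterraResolvent (measurable_tail G) (abs_tail_le_one G) lam x

theorem densitySeries_nonneg {lam : ℝ} (hlam : 0 ≤ lam) (G : Measure ℝ) {x : ℝ} (hx : 0 ≤ x) :
    0 ≤ densitySeries lam G x :=
  volterraResolvent_nonneg (tail_nonneg G) hlam hx

theorem densitySeries_eq (lam : ℝ) (G : Measure ℝ) (x : ℝ) :
    densitySeries lam G x =
      lam * tail G x + lam * ∫ y in (0 : ℝ)..x, tail G (x - y) * densitySeries lam G y :=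
  volterraResolvent_eq (measurable_tail G) (abs_tail_le_one G) lam x

theorem hasSum_integralSeries (lam : ℝ) (G : Measure ℝ) (x : ℝ) :
    HasSum (fun n : ℕ => lam ^ (n + 1) * ∫ y in (0 : ℝ)..x, convPow (tail G) n y)
      (∫ y in (0 : ℝ)..x, densitySeries lam G y) := by
  simpa only [one_mul] using! hasSum_integral_mul_convPow (measurable_tail G) (abs_tail_le_one G)
    lam (x := x) (k := fun _ => 1) intervalIntegrable_const

theorem integralSeries_eq (lam : ℝ) (G : Measure ℝ) (x : ℝ) :
    integralSeries lam G x = ∫ y in (0 : ℝ)..x, densitySeries lam G y :=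
  (hasSum_integralSeries lam G x).tsum_eq

theorem integralSeries_nonneg {lam : ℝ} (hlam : 0 ≤ lam) (G : Measure ℝ) {x : ℝ} (hx : 0 ≤ x) :
    0 ≤ integralSeries lam G x := by
  rw [integralSeries_eq]
  exact intervalIntegral.integral_nonneg hx fun y hy => densitySeries_nonneg hlam G hy.1

/-! ### The exponential distribution -/

theorem exp_neg_mul_primitive_add_integral {u : ℝ → ℝ} {t : ℝ}
    (hu : IntervalIntegrable u volume 0 t) (lam c : ℝ) :
    Real.exp (-(lam * t)) * (c + ∫ r in (0 : ℝ)..t, u r) +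
      ∫ s in (0 : ℝ)..t, Real.exp (-(lam * s)) * (lam * (c + ∫ r in (0 : ℝ)..s, u r) - u s) =
      c := by
  have hexp : AbsolutelyContinuousOnInterval (fun s => -Real.exp (-(lam * s))) 0 t :=
    ContDiffOn.absolutelyContinuousOnInterval (by fun_prop)
  have hprimitive : AbsolutelyContinuousOnInterval (fun s => c + ∫ r in (0 : ℝ)..s, u r) 0 t :=
    (ContDiffOn.absolutelyContinuousOnInterval contDiffOn_const).fun_add
      (hu.absolutelyContinuousOnInterval_intervalIntegral (by simp))
  have hparts := hexp.integral_deriv_mul_eq_sub hprimitive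
  have hderiv : ∫ s in (0 : ℝ)..t,
        Real.exp (-(lam * s)) * (lam * (c + ∫ r in (0 : ℝ)..s, u r) - u s) =
      ∫ s in (0 : ℝ)..t, (deriv (fun s => -Real.exp (-(lam * s))) s * (c + ∫ r in (0 : ℝ)..s, u r) +
        -Real.exp (-(lam * s)) * deriv (fun s => c + ∫ r in (0 : ℝ)..s, u r) s) := by
    refine intervalIntegral.integral_congr_ae ?_
    filter_upwards [hu.ae_hasDerivAt_integral] with s hs hst
    rw [((hs (uIoc_subset_uIcc hst) 0 (by simp)).const_add c).deriv,
      hasDerivAt_neg_exp_mul_exp.deriv]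
    ring
  rw [hderiv, hparts]
  simp

/-- The tail `e^{-λt}` of the exponential distribution, as an extended nonnegative number. It is
the probability that nobody arrives before time `t`. -/
noncomputable def expTail (lam t : ℝ) : ℝ≥0∞ := ENNReal.ofReal (Real.exp (-(lam * t)))

@[fun_prop]
theorem measurable_expTail (lam : ℝ) : Measurable (expTail lam) := by
  unfold expTail; fun_prop

theorem expMeasure_eq_withDensity {lam : ℝ} (hlam : 0 ≤ lam) :
    expMeasure lam =
      (volume.restrict (Ici 0)).withDensity fun s => ENNReal.ofReal lam * expTail lam s := by
  rw [← withDensity_indicator measurableSet_Ici]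
  change volume.withDensity (exponentialPDF lam) = _
  congr 1 with s
  by_cases hs : 0 ≤ s
  · rw [exponentialPDF_of_nonneg hs, indicator_of_mem (mem_Ici.2 hs),
      ENNReal.ofReal_mul hlam, expTail]
  · rw [exponentialPDF_of_neg (not_le.1 hs), indicator_of_notMem (mt mem_Ici.1 hs)]

theorem expMeasure_Iio_zero (lam : ℝ) : expMeasure lam (Iio 0) = 0 := by
  change volume.withDensity (exponentialPDF lam) (Iio 0) = 0
  rw [withDensity_apply _ measurableSet_Iio]
  exact lintegral_exponentialPDF_of_nonpos le_rfl

theorem expMeasure_Ioi {lam : ℝ} (hlam : 0 < lam) {t : ℝ} (ht : 0 ≤ t) :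
    expMeasure lam (Ioi t) = expTail lam t := by
  have := isProbabilityMeasure_expMeasure hlam
  have hle : Real.exp (-(lam * t)) ≤ 1 := Real.exp_le_one_iff.2 (by nlinarith)
  rw [← compl_Iic, prob_compl_eq_one_sub measurableSet_Iic, ← ofReal_cdf, cdf_expMeasure_eq hlam,
    if_pos ht, ← ENNReal.ofReal_one, ← ENNReal.ofReal_sub _ (sub_nonneg.2 hle), sub_sub_cancel,
    expTail]

theorem setLIntegral_Iic_expMeasure {lam : ℝ} (hlam : 0 ≤ lam) (t : ℝ) {g : ℝ → ℝ≥0∞}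
    (hg : Measurable g) :
    ∫⁻ s in Iic t, g s ∂expMeasure lam =
      ∫⁻ s in Icc 0 t, ENNReal.ofReal lam * expTail lam s * g s := by
  rw [expMeasure_eq_withDensity hlam,
    setLIntegral_withDensity_eq_setLIntegral_mul _ (by fun_prop) hg measurableSet_Iic,
    Measure.restrict_restrict measurableSet_Iic, inter_comm, Ici_inter_Iic]
  rfl

/-! ### Paths of the workload process -/

theorem arrivalTime_succ_eq (i : ℕ → ℝ) (n : ℕ) :
    arrivalTime i (n + 1) = i 0 + arrivalTime (fun k => i (k + 1)) n := by
  rw [arrivalTime, Finset.sum_range_succ', add_comm, arrivalTime]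

theorem workloadAtArrival_succ_eq (i s : ℕ → ℝ) (x : ℝ) (n : ℕ) :
    workloadAtArrival i s x (n + 1) = workloadAtArrival (fun k => i (k + 1)) (fun k => s (k + 1))
      (min (max (x - i 0) 0 + s 0) 1) n := by
  induction n with
  | zero => rfl
  | succ n ih => rw [workloadAtArrival, ih, workloadAtArrival]

theorem workloadAtArrival_le_one (i s : ℕ → ℝ) {x : ℝ} (hx : x ≤ 1) (n : ℕ) :
    workloadAtArrival i s x n ≤ 1 := by
  cases n with
  | zero => exact hx
  | succ n => exact min_le_right _ _

theorem workloadAtArrival_eq_of_one_le (i s : ℕ → ℝ) {x y : ℝ} (hx : x ≤ 1) (hy : y ≤ 1) {k n : ℕ}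
    (hk : 1 ≤ i k) (hn : k < n) : workloadAtArrival i s x n = workloadAtArrival i s y n := by
  induction n, hn using Nat.le_induction with
  | base =>
    have drained {z : ℝ} (hz : z ≤ 1) : max (workloadAtArrival i s z k - i k) 0 = 0 :=
      max_eq_right (sub_nonpos.2 ((workloadAtArrival_le_one i s hz k).trans hk))
    rw [workloadAtArrival, workloadAtArrival, drained hx, drained hy]
  | succ n _ ih => rw [workloadAtArrival, workloadAtArrival, ih]

section path

variable {i : ℕ → ℝ}

theorem monotone_arrivalTime (hi : ∀ n, 0 ≤ i n) : Monotone (arrivalTime i) :=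
  monotone_nat_of_le_succ fun n => by
    simpa only [arrivalTime, Finset.sum_range_succ] using! le_add_of_nonneg_right (hi n)

theorem arrivalTime_nonneg (hi : ∀ n, 0 ≤ i n) (n : ℕ) : 0 ≤ arrivalTime i n :=
  Finset.sum_nonneg fun k _ => hi k

theorem tendsto_arrivalTime_atTop (hi : ∀ n, 0 ≤ i n) (hfreq : ∃ᶠ n in atTop, 1 < i n) :
    Tendsto (arrivalTime i) atTop atTop :=
  (not_summable_iff_tendsto_nat_atTop_of_nonneg hi).1 fun hsum =>
    hfreq ((hsum.tendsto_atTop_zero.eventually_lt_const one_pos).mono fun _ h => h.not_gt)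

theorem arrivalCount_eq (hi : ∀ n, 0 ≤ i n) {t : ℝ} {n : ℕ} (hle : arrivalTime i n ≤ t)
    (hlt : t < arrivalTime i (n + 1)) : arrivalCount i t = n := by
  have hset : {k : ℕ | arrivalTime i k ≤ t} = Iic n := by
    ext k
    refine ⟨fun hk => ?_, fun hk => (monotone_arrivalTime hi hk).trans hle⟩
    exact Nat.lt_succ_iff.1 ((monotone_arrivalTime hi).reflect_lt (lt_of_le_of_lt hk hlt))
  rw [arrivalCount, hset, csSup_Iic]

theorem exists_arrivalTime_le_lt (hT : Tendsto (arrivalTime i) atTop atTop) {t : ℝ} (ht : 0 ≤ t) :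
    ∃ n, arrivalTime i n ≤ t ∧ t < arrivalTime i (n + 1) := by
  have hzero : ¬ t < arrivalTime i 0 := by simpa [arrivalTime] using ht
  obtain ⟨n, hn, hn'⟩ := Nat.exists_not_and_succ_of_not_zero_of_exists hzero
    (hT.eventually_gt_atTop t).exists
  exact ⟨n, not_lt.1 hn, hn'⟩

theorem workload_of_lt (hi : ∀ n, 0 ≤ i n) (s : ℕ → ℝ) (x : ℝ) {t : ℝ} (ht : 0 ≤ t)
    (h : t < i 0) : workload i s x t = max (x - t) 0 := by
  have hcount : arrivalCount i t = 0 :=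
    arrivalCount_eq hi (by simpa [arrivalTime] using ht) (by simpa [arrivalTime] using h)
  simp [workload, hcount, arrivalTime, workloadAtArrival]

theorem workload_of_le (hi : ∀ n, 0 ≤ i n) (hT : Tendsto (arrivalTime i) atTop atTop)
    (s : ℕ → ℝ) (x : ℝ) {t : ℝ} (h : i 0 ≤ t) :
    workload i s x t = workload (fun k => i (k + 1)) (fun k => s (k + 1))
      (min (max (x - i 0) 0 + s 0) 1) (t - i 0) := by
  obtain ⟨m, hle, hlt⟩ := exists_arrivalTime_le_lt hT ((hi 0).trans h)
  obtain ⟨n, rfl⟩ : ∃ n, m = n + 1 := by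
    refine Nat.exists_eq_succ_of_ne_zero ?_
    rintro rfl
    exact (by simpa [arrivalTime] using hlt : t < i 0).not_ge h
  have hcount := arrivalCount_eq hi hle hlt
  rw [arrivalTime_succ_eq] at hle hlt
  have hcount' : arrivalCount (fun k => i (k + 1)) (t - i 0) = n :=
    arrivalCount_eq (fun k => hi _) (by linarith) (by linarith)
  rw [workload, workload, hcount, hcount', workloadAtArrival_succ_eq, arrivalTime_succ_eq,
    sub_add_eq_sub_sub]

theorem workload_eq_of_one_le (hi : ∀ n, 0 ≤ i n) (hT : Tendsto (arrivalTime i) atTop atTop)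
    (s : ℕ → ℝ) {x y t : ℝ} (hx : x ≤ 1) (hy : y ≤ 1) {k : ℕ} (hk : 1 ≤ i k)
    (ht : arrivalTime i (k + 1) ≤ t) : workload i s x t = workload i s y t := by
  obtain ⟨n, hle, hlt⟩ := exists_arrivalTime_le_lt hT ((arrivalTime_nonneg hi _).trans ht)
  have hkn : k < n :=
    Nat.succ_lt_succ_iff.1 ((monotone_arrivalTime hi).reflect_lt (ht.trans_lt hlt))
  rw [workload, workload, arrivalCount_eq hi hle hlt,
    workloadAtArrival_eq_of_one_le i s hx hy hk hkn]

end path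

theorem nat_sSup_setOf_eq_iSup_ite (p : ℕ → Prop) [DecidablePred p] :
    sSup {n | p n} = ⨆ n, if p n then n else 0 := by
  by_cases hb : BddAbove {n | p n}
  · have hb' : BddAbove (range fun n => if p n then n else 0) :=
      hb.imp fun M hM => forall_mem_range.2 fun n => by
        split_ifs with hn
        exacts [hM hn, Nat.zero_le M]
    refine le_antisymm (csSup_le' fun n hn => (if_pos hn).ge.trans (le_ciSup hb' n))
      (ciSup_le' fun n => ?_)
    split_ifs with hn
    exacts [le_csSup hb hn, Nat.zero_le _]
  · have hb' : ¬ BddAbove (range fun n => if p n then n else 0) :=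
      fun h => hb (h.mono fun (n : ℕ) hn => mem_range.2 ⟨n, if_pos hn⟩)
    rw [csSup_of_not_bddAbove hb, ciSup_of_not_bddAbove hb']

section measurability

variable {α : Type*} [MeasurableSpace α] {i s : ℕ → α → ℝ} {x t : α → ℝ}

theorem measurable_arrivalTime (hi : ∀ n, Measurable (i n)) (n : ℕ) :
    Measurable fun a => arrivalTime (fun k => i k a) n :=
  Finset.measurable_fun_sum _ fun k _ => hi k

theorem measurable_workloadAtArrival (hi : ∀ n, Measurable (i n)) (hs : ∀ n, Measurable (s n))
    (hx : Measurable x) (n : ℕ) :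
    Measurable fun a => workloadAtArrival (fun k => i k a) (fun k => s k a) (x a) n := by
  induction n with
  | zero => exact hx
  | succ n ih => exact ((((ih.sub (hi n)).max measurable_const).add (hs n)).min measurable_const)

theorem measurable_arrivalCount (hi : ∀ n, Measurable (i n)) (ht : Measurable t) :
    Measurable fun a => arrivalCount (fun k => i k a) (t a) := by
  classical
  simp_rw [arrivalCount, nat_sSup_setOf_eq_iSup_ite]
  exact Measurable.iSup fun n =>
    Measurable.ite (measurableSet_le (measurable_arrivalTime hi n) ht) measurable_const
      measurable_const

theorem measurable_workload (hi : ∀ n, Measurable (i n)) (hs : ∀ n, Measurable (s n))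
    (hx : Measurable x) (ht : Measurable t) :
    Measurable fun a => workload (fun k => i k a) (fun k => s k a) (x a) (t a) := by
  have hcount (n : ℕ) : Measurable fun a =>
      max (workloadAtArrival (fun k => i k a) (fun k => s k a) (x a) n -
        (t a - arrivalTime (fun k => i k a) n)) 0 :=
    ((measurable_workloadAtArrival hi hs hx n).sub
      (ht.sub (measurable_arrivalTime hi n))).max measurable_const
  exact (measurable_from_prod_countable_left hcount :
      Measurable fun p : α × ℕ => max (workloadAtArrival (fun k => i k p.1) (fun k => s k p.1)
        (x p.1) p.2 - (t p.1 - arrivalTime (fun k => i k p.1) p.2)) 0).comp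
    (measurable_id.prodMk (measurable_arrivalCount hi ht))

end measurability

/-! ### The random input and its regeneration at the first arrival -/

theorem measure_prodMk_mem_eq_lintegral {Ω α β : Type*} [MeasurableSpace Ω] [MeasurableSpace α]
    [MeasurableSpace β] {P : Measure Ω} [IsFiniteMeasure P] {X : Ω → α} {Y : Ω → β}
    (hXY : IndepFun X Y P) (hX : Measurable X) (hY : Measurable Y) {B : Set (α × β)}
    (hB : MeasurableSet B) :
    P {ω | (X ω, Y ω) ∈ B} = ∫⁻ a, P {ω | (a, Y ω) ∈ B} ∂P.map X := by
  change P ((fun ω => (X ω, Y ω)) ⁻¹' B) = _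
  rw [← Measure.map_apply (hX.prodMk hY) hB,
    (indepFun_iff_map_prod_eq_prod_map_map hX.aemeasurable hY.aemeasurable).1 hXY,
    Measure.prod_apply hB]
  exact lintegral_congr fun a => Measure.map_apply hY (measurable_prodMk_left hB)

theorem comap_pi_le_iSup_comap {Ω ι κ β : Type*} [MeasurableSpace β] (X : ι → Ω → β) (a : κ → ι) :
    MeasurableSpace.comap (fun ω k => X (a k) ω) MeasurableSpace.pi ≤
      ⨆ i ∈ range a, MeasurableSpace.comap (X i) inferInstance := by
  simp_rw [MeasurableSpace.pi, MeasurableSpace.comap_iSup, MeasurableSpace.comap_comp]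
  exact iSup_le fun k => le_iSup₂_of_le (a k) (mem_range_self k) le_rfl

theorem indepFun_pi_of_disjoint {Ω ι κ κ' β : Type*} [MeasurableSpace Ω] [MeasurableSpace β]
    {P : Measure Ω} {X : ι → Ω → β} (hX : ∀ i, Measurable (X i)) (hind : iIndepFun X P)
    {a : κ → ι} {b : κ' → ι} (hab : Disjoint (range a) (range b)) :
    IndepFun (fun ω k => X (a k) ω) (fun ω k => X (b k) ω) P :=
  indep_of_indep_of_le_left (indep_of_indep_of_le_right
    (indep_iSup_of_disjoint (fun i => (hX i).comap_le) hind hab) (comap_pi_le_iSup_comap X b))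
    (comap_pi_le_iSup_comap X a)

section input

variable {Ω Ω' : Type*} [MeasurableSpace Ω] [MeasurableSpace Ω'] {P : Measure Ω} {P' : Measure Ω'}
  {lam : ℝ} {G : Measure ℝ} {I S : ℕ → Ω → ℝ} {I' S' : ℕ → Ω' → ℝ}

theorem IsInput.measurable_elim (h : IsInput P lam G I S) (j : ℕ ⊕ ℕ) :
    Measurable (Sum.elim I S j) :=
  Sum.casesOn j h.measurable_I h.measurable_S

theorem IsInput.isProbabilityMeasure_service (h : IsInput P lam G I S) :
    IsProbabilityMeasure G := by
  have := h.indep.isProbabilityMeasure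
  rw [← h.law_S 0]
  exact Measure.isProbabilityMeasure_map (h.measurable_S 0).aemeasurable

theorem IsInput.ae_nonneg (h : IsInput P lam G I S) : ∀ᵐ ω ∂P, ∀ n, 0 ≤ I n ω := by
  refine ae_all_iff.2 fun n => ?_
  have hlaw : ∀ᵐ s ∂P.map (I n), 0 ≤ s := by
    simpa [h.law_I n, ae_iff] using! expMeasure_Iio_zero lam
  exact ae_of_ae_map (h.measurable_I n).aemeasurable hlaw

theorem IsInput.measure_lt (hlam : 0 < lam) (h : IsInput P lam G I S) (n : ℕ) {t : ℝ}
    (ht : 0 ≤ t) : P {ω | t < I n ω} = expTail lam t := by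
  rw [← expMeasure_Ioi hlam ht, ← h.law_I n, Measure.map_apply (h.measurable_I n) measurableSet_Ioi]
  rfl

theorem IsInput.ae_frequently_one_lt (hlam : 0 < lam) (h : IsInput P lam G I S) :
    ∀ᵐ ω ∂P, ∃ᶠ n in atTop, 1 < I n ω := by
  have := h.indep.isProbabilityMeasure
  have hmeas (n : ℕ) : MeasurableSet {ω | 1 < I n ω} :=
    measurableSet_lt measurable_const (h.measurable_I n)
  have hindep : iIndepSet (fun n => {ω | 1 < I n ω}) P := by
    rw [iIndepSet_iff_meas_biInter hmeas]
    exact fun s => (h.indep.precomp Sum.inl_injective).meas_biInter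
      fun n _ => ⟨Ioi 1, measurableSet_Ioi, rfl⟩
  have hsum : ∑' n, P {ω | 1 < I n ω} = ∞ := by
    simp_rw [h.measure_lt hlam _ zero_le_one]
    exact ENNReal.tsum_const_eq_top_of_ne_zero (by simp [expTail, Real.exp_pos])
  have hlimsup : ∀ᵐ ω ∂P, ω ∈ limsup (fun n => {ω | 1 < I n ω}) atTop :=
    mem_ae_iff_prob_eq_one (MeasurableSet.measurableSet_limsup hmeas) |>.2
      (measure_limsup_eq_one hmeas hindep hsum)
  simpa only [mem_limsup_iff_frequently_mem] using! hlimsup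

theorem IsInput.ae_tendsto_arrivalTime (hlam : 0 < lam) (h : IsInput P lam G I S) :
    ∀ᵐ ω ∂P, Tendsto (arrivalTime fun k => I k ω) atTop atTop := by
  filter_upwards [h.ae_nonneg, h.ae_frequently_one_lt hlam] with ω hnonneg hfreq
  exact tendsto_arrivalTime_atTop hnonneg hfreq

theorem IsInput.shift (h : IsInput P lam G I S) :
    IsInput P lam G (fun n => I (n + 1)) (fun n => S (n + 1)) where
  measurable_I n := h.measurable_I (n + 1)
  measurable_S n := h.measurable_S (n + 1)
  law_I n := h.law_I (n + 1)
  law_S n := h.law_S (n + 1)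
  indep := by
    convert h.indep.precomp (Nat.succ_injective.sumMap Nat.succ_injective) using 1
    ext (n | n) <;> rfl

theorem IsInput.map_eq_map (h : IsInput P lam G I S) (h' : IsInput P' lam G I' S') :
    P.map (fun ω j => Sum.elim I S j ω) = P'.map (fun ω j => Sum.elim I' S' j ω) := by
  rw [h.indep.map_fun_eq_infinitePi_map h.measurable_elim,
    h'.indep.map_fun_eq_infinitePi_map h'.measurable_elim]
  congr 1
  ext1 (n | n)
  exacts [(h.law_I n).trans (h'.law_I n).symm, (h.law_S n).trans (h'.law_S n).symm]

theorem IsInput.transition_eq_map (h : IsInput P lam G I S) (t x : ℝ) {A : Set ℝ}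
    (hA : MeasurableSet A) :
    transition P I S t x A = P.map (fun ω j => Sum.elim I S j ω)
      {w | workload (fun n => w (Sum.inl n)) (fun n => w (Sum.inr n)) x t ∈ A} := by
  rw [Measure.map_apply (measurable_pi_iff.2 h.measurable_elim)]
  · rfl
  · exact measurable_workload (i := fun n (w : ℕ ⊕ ℕ → ℝ) => w (Sum.inl n))
      (s := fun n w => w (Sum.inr n)) (by fun_prop) (by fun_prop) measurable_const
      measurable_const hA

theorem IsInput.transition_congr (h : IsInput P lam G I S) (h' : IsInput P' lam G I' S')
    (t x : ℝ) {A : Set ℝ} (hA : MeasurableSet A) :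
    transition P I S t x A = transition P' I' S' t x A := by
  rw [h.transition_eq_map t x hA, h'.transition_eq_map t x hA, h.map_eq_map h']

theorem IsInput.measurable_transition_comp (h : IsInput P lam G I S) {A : Set ℝ}
    (hA : MeasurableSet A) {β : Type*} [MeasurableSpace β] {t x : β → ℝ} (ht : Measurable t)
    (hx : Measurable x) : Measurable fun b => transition P I S (t b) (x b) A := by
  have := h.indep.isProbabilityMeasure
  have hworkload : Measurable fun p : β × Ω =>
      workload (fun n => I n p.2) (fun n => S n p.2) (x p.1) (t p.1) :=
    measurable_workload (fun n => (h.measurable_I n).comp measurable_snd)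
      (fun n => (h.measurable_S n).comp measurable_snd) (hx.comp measurable_fst)
      (ht.comp measurable_fst)
  exact measurable_measure_prodMk_left (ν := P) (hworkload hA)

theorem IsInput.indepFun_head_shift (h : IsInput P lam G I S) :
    IndepFun (fun ω => (I 0 ω, S 0 ω))
      (fun ω j => Sum.elim (fun n => I (n + 1)) (fun n => S (n + 1)) j ω) P := by
  have hindep := indepFun_pi_of_disjoint h.measurable_elim h.indep
    (a := (![Sum.inl 0, Sum.inr 0] : Fin 2 → ℕ ⊕ ℕ)) (b := Sum.map Nat.succ Nat.succ) (by
      rw [Set.disjoint_left]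
      rintro _ ⟨k, rfl⟩ ⟨j | j, hj⟩ <;> fin_cases k <;> simp at hj)
  convert hindep.comp (φ := fun w => (w 0, w 1)) (ψ := id) (by fun_prop) measurable_id using 1
  · rfl
  · ext ω (n | n) <;> rfl

theorem IsInput.map_head (h : IsInput P lam G I S) :
    P.map (fun ω => (I 0 ω, S 0 ω)) = (expMeasure lam).prod G := by
  have := h.indep.isProbabilityMeasure
  rw [← h.law_I 0, ← h.law_S 0]
  exact (indepFun_iff_map_prod_eq_prod_map_map (h.measurable_I 0).aemeasurable
    (h.measurable_S 0).aemeasurable).1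
      (h.indep.indepFun (i := Sum.inl 0) (j := Sum.inr 0) (by simp))

theorem IsInput.measure_restart (hlam : 0 < lam) (h : IsInput P lam G I S) {A : Set ℝ}
    (hA : MeasurableSet A) (t x : ℝ) :
    P {ω | I 0 ω ≤ t ∧ workload (fun n => I (n + 1) ω) (fun n => S (n + 1) ω)
        (min (max (x - I 0 ω) 0 + S 0 ω) 1) (t - I 0 ω) ∈ A} =
      ∫⁻ s in Iic t, ∫⁻ y, transition P I S (t - s) (min (max (x - s) 0 + y) 1) A ∂G
        ∂expMeasure lam := by
  have := h.indep.isProbabilityMeasure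
  have := isProbabilityMeasure_expMeasure hlam
  have := h.isProbabilityMeasure_service
  let B : Set ((ℝ × ℝ) × (ℕ ⊕ ℕ → ℝ)) := {p | p.1.1 ≤ t ∧
    workload (fun n => p.2 (Sum.inl n)) (fun n => p.2 (Sum.inr n))
      (min (max (x - p.1.1) 0 + p.1.2) 1) (t - p.1.1) ∈ A}
  have hB : MeasurableSet B :=
    (measurableSet_le measurable_fst.fst measurable_const).inter <|
      measurable_workload (i := fun n (p : (ℝ × ℝ) × (ℕ ⊕ ℕ → ℝ)) => p.2 (Sum.inl n))
        (s := fun n p => p.2 (Sum.inr n)) (by fun_prop) (by fun_prop) (by fun_prop) (by fun_prop) hA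
  have hsection (s y : ℝ) :
      P {ω | ((s, y), fun j => Sum.elim (fun n => I (n + 1)) (fun n => S (n + 1)) j ω) ∈ B} =
        (Iic t).indicator (fun s => transition P I S (t - s) (min (max (x - s) 0 + y) 1) A) s := by
    by_cases hs : s ≤ t
    · rw [indicator_of_mem (mem_Iic.2 hs), h.transition_congr h.shift _ _ hA]
      simp [B, hs, transition]
    · simp [B, hs]
  have hmeas : Measurable fun p : ℝ × ℝ =>
      P {ω | (p, fun j => Sum.elim (fun n => I (n + 1)) (fun n => S (n + 1)) j ω) ∈ B} :=
    measurable_measure_prodMk_left (ν := P)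
      ((measurable_fst.prodMk
        ((measurable_pi_iff.2 h.shift.measurable_elim).comp measurable_snd)) hB)
  refine (measure_prodMk_mem_eq_lintegral h.indepFun_head_shift
    ((h.measurable_I 0).prodMk (h.measurable_S 0)) (measurable_pi_iff.2 h.shift.measurable_elim)
    hB).trans ?_
  rw [h.map_head, lintegral_prod _ hmeas.aemeasurable, ← lintegral_indicator measurableSet_Iic]
  simp only [hsection]
  refine lintegral_congr fun s => ?_
  by_cases hs : s ∈ Iic t <;> simp [hs]

theorem IsInput.transition_eq (hlam : 0 < lam) (h : IsInput P lam G I S) {A : Set ℝ}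
    (hA : MeasurableSet A) {t : ℝ} (ht : 0 ≤ t) (x : ℝ) :
    transition P I S t x A =
      expTail lam t * A.indicator 1 (max (x - t) 0) +
      ∫⁻ s in Icc 0 t, ENNReal.ofReal lam * expTail lam s *
        ∫⁻ y, transition P I S (t - s) (min (max (x - s) 0 + y) 1) A ∂G := by
  have := h.isProbabilityMeasure_service
  have hmeas : Measurable fun p : ℝ × ℝ =>
      transition P I S (t - p.1) (min (max (x - p.1) 0 + p.2) 1) A :=
    h.measurable_transition_comp hA (by fun_prop) (by fun_prop)
  rw [← setLIntegral_Iic_expMeasure hlam.le t hmeas.lintegral_prod_right',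
    ← h.measure_restart hlam hA t x, ← h.measure_lt hlam 0 ht, transition,
    ← measure_inter_add_sdiff _
      (measurableSet_lt (f := fun _ => t) measurable_const (h.measurable_I 0))]
  congr 1
  · have hdrain : ∀ᵐ ω ∂P, (workload (fun n => I n ω) (fun n => S n ω) x t ∈ A ∧ t < I 0 ω ↔
        max (x - t) 0 ∈ A ∧ t < I 0 ω) := by
      filter_upwards [h.ae_nonneg] with ω hnonneg
      exact and_congr_left fun hlt => by rw [workload_of_lt hnonneg _ _ ht hlt]
    refine (measure_congr (hdrain.mono fun _ => propext)).trans ?_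
    change P {ω | max (x - t) 0 ∈ A ∧ t < I 0 ω} = _
    by_cases hxA : max (x - t) 0 ∈ A <;> simp [hxA]
  · have hrestart : ∀ᵐ ω ∂P, (workload (fun n => I n ω) (fun n => S n ω) x t ∈ A ∧ ¬ t < I 0 ω ↔
        I 0 ω ≤ t ∧ workload (fun n => I (n + 1) ω) (fun n => S (n + 1) ω)
          (min (max (x - I 0 ω) 0 + S 0 ω) 1) (t - I 0 ω) ∈ A) := by
      filter_upwards [h.ae_nonneg, h.ae_tendsto_arrivalTime hlam] with ω hnonneg hT
      rw [not_lt, and_comm]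
      exact and_congr_right fun hle => by rw [workload_of_le hnonneg hT _ _ hle]
    exact measure_congr (hrestart.mono fun _ => propext)

end input

/-! ### Coupling and uniqueness -/

/-- The event that no inter-arrival time longer than `1`, the capacity, is completed by time `t`.
Off this event the workload at time `t` does not depend on the initial state. -/
def noLongGap {Ω : Type*} (I : ℕ → Ω → ℝ) (t : ℝ) : Set Ω :=
  {ω | ∀ k, 1 < I k ω → t < arrivalTime (fun n => I n ω) (k + 1)}

section coupling

variable {Ω : Type*} [MeasurableSpace Ω] {P : Measure Ω} {lam : ℝ} {G : Measure ℝ}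
  {I S : ℕ → Ω → ℝ}

theorem measurableSet_noLongGap (hI : ∀ n, Measurable (I n)) (t : ℝ) :
    MeasurableSet (noLongGap I t) :=
  measurableSet_setOfPred.2 <| Measurable.forall fun k =>
    (measurableSet_setOfPred.1 (measurableSet_lt measurable_const (hI k))).imp <|
      measurableSet_setOfPred.1 (measurableSet_lt measurable_const (measurable_arrivalTime hI _))

theorem IsInput.tendsto_measure_noLongGap (hlam : 0 < lam) (h : IsInput P lam G I S) :
    Tendsto (fun N : ℕ => P (noLongGap I N)) atTop (𝓝 0) := by
  have := h.indep.isProbabilityMeasure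
  have hanti : Antitone fun N : ℕ => noLongGap I N := fun M N hMN ω hω k hk =>
    (Nat.cast_le.2 hMN).trans_lt (hω k hk)
  have hinter : P (⋂ N : ℕ, noLongGap I N) = 0 := by
    refine measure_eq_zero_iff_ae_notMem.2 ?_
    filter_upwards [h.ae_frequently_one_lt hlam] with ω hfreq hmem
    obtain ⟨k, hk⟩ := hfreq.exists
    obtain ⟨N, hN⟩ := exists_nat_gt (arrivalTime (fun n => I n ω) (k + 1))
    exact hN.not_gt (mem_iInter.1 hmem N k hk)
  rw [← hinter]
  exact tendsto_measure_iInter_atTop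
    (fun N => (measurableSet_noLongGap h.measurable_I N).nullMeasurableSet) hanti
    ⟨0, measure_ne_top _ _⟩

theorem IsInput.transition_le_add (hlam : 0 < lam) (h : IsInput P lam G I S) (t : ℝ) {x y : ℝ}
    (hx : x ≤ 1) (hy : y ≤ 1) (A : Set ℝ) :
    transition P I S t x A ≤ transition P I S t y A + P (noLongGap I t) := by
  refine (measure_mono_ae ?_).trans (measure_union_le _ _)
  filter_upwards [h.ae_nonneg, h.ae_tendsto_arrivalTime hlam] with ω hnonneg hT hmem
  by_cases hω : ω ∈ noLongGap I t
  · exact Or.inr hω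
  · obtain ⟨k, hk, hkt⟩ : ∃ k, 1 < I k ω ∧ arrivalTime (fun n => I n ω) (k + 1) ≤ t := by
      simpa [noLongGap] using hω
    refine Or.inl ?_
    change workload _ _ _ _ ∈ A
    rwa [workload_eq_of_one_le hnonneg hT _ hy hx hk.le hkt]

variable {π π' : Measure ℝ}

theorem IsInvariantDistribution.ae_le_one (hπ : IsInvariantDistribution P I S π) :
    ∀ᵐ x ∂π, x ≤ 1 :=
  (measure_eq_zero_iff_ae_notMem.1 hπ.supported).mono fun _ hx => (not_not.1 hx).2

theorem IsInvariantDistribution.measure_le_add (hlam : 0 < lam) (h : IsInput P lam G I S)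
    (hπ : IsInvariantDistribution P I S π) (hπ' : IsInvariantDistribution P I S π') {t : ℝ}
    (ht : 0 ≤ t) {A : Set ℝ} (hA : MeasurableSet A) : π A ≤ π' A + P (noLongGap I t) := by
  have := hπ.isProbabilityMeasure
  have := hπ'.isProbabilityMeasure
  have hle : ∀ᵐ y ∂π', π A ≤ transition P I S t y A + P (noLongGap I t) :=
    hπ'.ae_le_one.mono fun y hy =>
      calc π A = ∫⁻ x, transition P I S t x A ∂π := (hπ.invariant t ht A hA).symm
        _ ≤ ∫⁻ _, (transition P I S t y A + P (noLongGap I t)) ∂π :=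
            lintegral_mono_ae (hπ.ae_le_one.mono fun x hx => h.transition_le_add hlam t hx hy A)
        _ = _ := by simp
  calc π A = ∫⁻ _, π A ∂π' := by simp
    _ ≤ ∫⁻ y, (transition P I S t y A + P (noLongGap I t)) ∂π' := lintegral_mono_ae hle
    _ = π' A + P (noLongGap I t) := by
        rw [lintegral_add_right _ measurable_const, hπ'.invariant t ht A hA]
        simp

theorem IsInvariantDistribution.le (hlam : 0 < lam) (h : IsInput P lam G I S)
    (hπ : IsInvariantDistribution P I S π) (hπ' : IsInvariantDistribution P I S π') : π ≤ π' := by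
  refine Measure.le_iff.2 fun A hA => ?_
  have hlim : Tendsto (fun N : ℕ => π' A + P (noLongGap I N)) atTop (𝓝 (π' A + 0)) :=
    (h.tendsto_measure_noLongGap hlam).const_add _
  simpa using ge_of_tendsto' hlim fun N => hπ.measure_le_add hlam h hπ' N.cast_nonneg hA

theorem IsInvariantDistribution.eq (hlam : 0 < lam) (h : IsInput P lam G I S)
    (hπ : IsInvariantDistribution P I S π) (hπ' : IsInvariantDistribution P I S π') : π = π' :=
  le_antisymm (hπ.le hlam h hπ') (hπ'.le hlam h hπ)

end coupling

/-! ### Invariance from the renewal equation and the balance equation -/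

theorem setLIntegral_Icc_reflect (g : ℝ → ℝ≥0∞) (a b : ℝ) :
    ∫⁻ s in Icc a b, g (a + b - s) = ∫⁻ s in Icc a b, g s := by
  have hreflect :=
    (Measure.measurePreserving_sub_left volume (a + b)).setLIntegral_comp_preimage_emb
      (MeasurableEquiv.subLeft (a + b)).measurableEmbedding g (Icc a b)
  rwa [preimage_const_sub_Icc, add_sub_cancel_right, add_sub_cancel_left] at hreflect

theorem lintegral_triangle_swap {ψ : ℝ → ℝ → ℝ≥0∞} (hψ : Measurable (Function.uncurry ψ))
    (a b : ℝ) :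
    ∫⁻ s in Icc a b, ∫⁻ u in Icc a s, ψ s u = ∫⁻ u in Icc a b, ∫⁻ s in Icc u b, ψ s u := by
  have hcut : Measurable (Function.uncurry fun s u => (Iic s).indicator (ψ s) u) :=
    hψ.indicator (s := {p : ℝ × ℝ | p.2 ≤ p.1}) (measurableSet_le measurable_snd measurable_fst)
  have hrow : ∀ s ∈ Icc a b,
      ∫⁻ u in Icc a s, ψ s u = ∫⁻ u in Icc a b, (Iic s).indicator (ψ s) u := fun s hs => by
    rw [setLIntegral_indicator measurableSet_Iic, ← Ici_inter_Iic, ← Ici_inter_Iic,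
      inter_left_comm, Iic_inter_Iic, min_eq_left hs.2]
  have hcol : ∀ u ∈ Icc a b,
      ∫⁻ s in Icc u b, ψ s u = ∫⁻ s in Icc a b, (Iic s).indicator (ψ s) u := fun u hu => by
    change _ = ∫⁻ s in Icc a b, (Ici u).indicator (ψ · u) s
    rw [setLIntegral_indicator measurableSet_Ici, ← Ici_inter_Iic, ← Ici_inter_Iic, ← inter_assoc,
      Ici_inter_Ici, sup_of_le_left hu.1]
  rw [setLIntegral_congr_fun measurableSet_Icc hrow, setLIntegral_congr_fun measurableSet_Icc hcol]
  exact lintegral_lintegral_swap hcut.aemeasurable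

theorem lintegral_triangle_shear {D : ℝ → ℝ → ℝ≥0∞} (hD : Measurable (Function.uncurry D))
    (t : ℝ) :
    ∫⁻ s in Icc 0 t, ∫⁻ u in Icc 0 s, D u (t - s) =
      ∫⁻ s in Icc 0 t, ∫⁻ u in Icc 0 s, D u (s - u) := by
  rw [lintegral_triangle_swap (ψ := fun s u => D u (t - s))
      (hD.comp (measurable_snd.prodMk (measurable_const.sub measurable_fst))),
    lintegral_triangle_swap (ψ := fun s u => D u (s - u))
      (hD.comp (measurable_snd.prodMk (measurable_fst.sub measurable_snd)))]
  refine lintegral_congr fun u => ?_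
  rw [← setLIntegral_Icc_reflect (fun s => D u (s - u))]
  simp only [sub_right_comm _ _ u, add_sub_cancel_left]

theorem setLIntegral_eq_of_renewal {N a b : ℝ → ℝ≥0∞} {D : ℝ → ℝ → ℝ≥0∞} (ha : Measurable a)
    (hb : Measurable b) (hD : Measurable (Function.uncurry D)) {t : ℝ}
    (hNa : ∀ s ∈ Icc 0 t, N (t - s) = a s + ∫⁻ u in Icc 0 s, D u (t - s))
    (hNb : ∀ s ∈ Icc 0 t, N s = b s + ∫⁻ u in Icc 0 s, D u (s - u))
    (hN : ∫⁻ s in Icc 0 t, N s ≠ ∞) :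
    ∫⁻ s in Icc 0 t, a s = ∫⁻ s in Icc 0 t, b s := by
  have hreflect := setLIntegral_Icc_reflect N 0 t
  rw [zero_add, setLIntegral_congr_fun measurableSet_Icc hNa, lintegral_add_left ha,
    lintegral_triangle_shear hD, setLIntegral_congr_fun measurableSet_Icc hNb,
    lintegral_add_left hb] at hreflect
  rw [setLIntegral_congr_fun measurableSet_Icc hNb, lintegral_add_left hb] at hN
  exact (ENNReal.add_left_inj (ENNReal.add_ne_top.1 hN).2).1 hreflect

section flow

variable {X : Type*} [MeasurableSpace X] {φ : ℝ → X → X} {E : ℝ → ℝ≥0∞} {c : ℝ≥0∞}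
  {f : X → ℝ≥0∞} {k : ℝ → X → ℝ≥0∞}

theorem lintegral_renewal (hφ : Measurable (Function.uncurry φ)) (hE : Measurable E)
    (hf : Measurable f) (hk : Measurable (Function.uncurry k)) (ρ : Measure X) [SFinite ρ]
    {p : X → ℝ≥0∞} {t : ℝ}
    (hp : ∀ x, p x = E t * f (φ t x) + ∫⁻ s in Icc 0 t, c * E s * k (t - s) (φ s x)) :
    ∫⁻ x, p x ∂ρ = E t * ∫⁻ x, f (φ t x) ∂ρ +
      ∫⁻ s in Icc 0 t, c * E s * ∫⁻ x, k (t - s) (φ s x) ∂ρ := by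
  have hfφ : Measurable fun x => f (φ t x) := hf.comp hφ.of_uncurry_left
  have hjoint : Measurable fun q : X × ℝ => c * E q.2 * k (t - q.2) (φ q.2 q.1) :=
    ((hE.comp measurable_snd).const_mul c).mul
      (hk.comp ((measurable_snd.const_sub t).prodMk (hφ.comp measurable_swap)))
  simp_rw [hp]
  rw [lintegral_add_left (hfφ.const_mul _), lintegral_const_mul _ hfφ,
    lintegral_lintegral_swap hjoint.aemeasurable]
  congr 1
  exact lintegral_congr fun s => lintegral_const_mul _ (hk.of_uncurry_left.comp hφ.of_uncurry_left)

variable {ν M : Measure X} [IsFiniteMeasure ν] [SFinite M] {p : ℝ → X → ℝ≥0∞}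

/-- `p` is the semigroup acting on `f`, the jumps occur with intensity `c` and move the state by a
kernel taking `p` to `k` and `ν` to `M`; `φ` is the flow between the jumps and `E` the probability
of no jump. Integrating over `[0, t]` the function `N s = c ∫ k s ∂ν = c ∫ p s ∂M`, expanded by the
balance equation at time `t - s` and by the renewal equation at time `s`, shows that the two
equations have the same correction term. -/
theorem lintegral_eq_of_renewal_of_balance (hφ : Measurable (Function.uncurry φ))
    (hE : Measurable E) (hc : c ≠ ∞) (hf : Measurable f) (hk : Measurable (Function.uncurry k))
    (hk_le : ∀ t x, k t x ≤ 1)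
    (hrenewal : ∀ t, 0 ≤ t → ∀ x,
      p t x = E t * f (φ t x) + ∫⁻ s in Icc 0 t, c * E s * k (t - s) (φ s x))
    (hjump : ∀ t, ∫⁻ x, p t x ∂M = ∫⁻ x, k t x ∂ν)
    (hbalance : ∀ t, 0 ≤ t → ∀ g : X → ℝ≥0∞, Measurable g → ∫⁻ x, g x ∂ν =
      E t * ∫⁻ x, g (φ t x) ∂ν + ∫⁻ s in Icc 0 t, c * E s * ∫⁻ x, g (φ s x) ∂M)
    {t : ℝ} (ht : 0 ≤ t) : ∫⁻ x, p t x ∂ν = ∫⁻ x, f x ∂ν := by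
  have hkφ : Measurable fun q : (ℝ × ℝ) × X => k q.1.2 (φ q.1.1 q.2) :=
    hk.comp (measurable_fst.snd.prodMk (hφ.comp (measurable_fst.fst.prodMk measurable_snd)))
  have hD : Measurable (Function.uncurry fun u w => c * E u * ∫⁻ x, k w (φ u x) ∂M) :=
    ((hE.comp measurable_fst).const_mul c).mul hkφ.lintegral_prod_right'
  have hDcomp {w : ℝ → ℝ} (hw : Measurable w) :
      Measurable fun u => c * E u * ∫⁻ x, k (w u) (φ u x) ∂M :=
    hD.comp (measurable_id.prodMk hw)
  have ha : Measurable fun s => c * E s * ∫⁻ x, k (t - s) (φ s x) ∂ν :=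
    (hE.const_mul c).mul <| Measurable.lintegral_prod_right' <|
      hkφ.comp ((measurable_fst.prodMk (measurable_fst.const_sub t)).prodMk measurable_snd)
  have hb : Measurable fun s => c * E s * ∫⁻ x, f (φ s x) ∂M :=
    (hE.const_mul c).mul (hf.comp hφ).lintegral_prod_right'
  have hN : ∫⁻ s in Icc 0 t, c * ∫⁻ x, k s x ∂ν ≠ ∞ := by
    refine ne_top_of_le_ne_top (b := ∫⁻ _ in Icc 0 t, c * ν univ) ?_ ?_
    · simp [ENNReal.mul_eq_top, hc]
    · gcongr with s
      simpa using lintegral_mono (μ := ν) (hk_le s)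
  have hcorrection : ∫⁻ s in Icc 0 t, c * E s * ∫⁻ x, k (t - s) (φ s x) ∂ν =
      ∫⁻ s in Icc 0 t, c * E s * ∫⁻ x, f (φ s x) ∂M := by
    refine setLIntegral_eq_of_renewal (N := fun s => c * ∫⁻ x, k s x ∂ν)
      (D := fun u w => c * (c * E u * ∫⁻ x, k w (φ u x) ∂M)) ha hb (hD.const_mul c)
      (fun s hs => ?_) (fun s hs => ?_) hN
    · rw [hbalance s hs.1 _ hk.of_uncurry_left, mul_add, ← mul_assoc]
      exact congrArg _ (lintegral_const_mul _ (hDcomp measurable_const)).symm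
    · rw [← hjump, lintegral_renewal hφ hE hf hk M (hrenewal s hs.1), mul_add, ← mul_assoc]
      exact congrArg _ (lintegral_const_mul _ (hDcomp (measurable_id.const_sub s))).symm
  rw [lintegral_renewal hφ hE hf hk ν (hrenewal t ht), hcorrection, ← hbalance t ht f hf]

end flow

/-! ### The level crossing identity and the balance equation -/

section levelCrossing

variable {ν M : Measure ℝ} [IsFiniteMeasure ν] [IsFiniteMeasure M] {lam : ℝ}

theorem monotone_measureReal_Iic (ν : Measure ℝ) [IsFiniteMeasure ν] :
    Monotone fun x => ν.real (Iic x) :=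
  fun _ _ hab => measureReal_mono (Iic_subset_Iic.2 hab)

theorem measureReal_Iic_eq_of_levelCrossing
    (hlevel : ∀ x, 0 ≤ x → ν.real (Iic x) = ν.real (Iic 0) +
      ∫ y in (0 : ℝ)..x, lam * (ν.real (Iic y) - M.real (Iic y)))
    {x t : ℝ} (hx : 0 ≤ x) (ht : 0 ≤ t) :
    ν.real (Iic x) = Real.exp (-(lam * t)) * ν.real (Iic (x + t)) +
      ∫ s in (0 : ℝ)..t, lam * Real.exp (-(lam * s)) * M.real (Iic (x + s)) := by
  set u : ℝ → ℝ := fun y => lam * (ν.real (Iic y) - M.real (Iic y))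
  have hu (a b : ℝ) : IntervalIntegrable u volume a b :=
    ((monotone_measureReal_Iic ν).intervalIntegrable.sub
      (monotone_measureReal_Iic M).intervalIntegrable).const_mul lam
  have hincrement : ∀ s, 0 ≤ s →
      ν.real (Iic x) + ∫ r in (0 : ℝ)..s, u (x + r) = ν.real (Iic (x + s)) := fun s hs => by
    rw [intervalIntegral.integral_comp_add_left u, add_zero, hlevel x hx,
      hlevel _ (add_nonneg hx hs), add_assoc,
      intervalIntegral.integral_add_adjacent_intervals (hu _ _) (hu _ _)]
  have hshift : IntervalIntegrable (fun s => u (x + s)) volume 0 t := by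
    simpa using (hu x (x + t)).comp_add_left x
  rw [← exp_neg_mul_primitive_add_integral hshift lam (ν.real (Iic x)), hincrement t ht]
  congr 1
  refine intervalIntegral.integral_congr fun s hs => ?_
  rw [uIcc_of_le ht] at hs
  simp only [hincrement s hs.1, u]
  ring

theorem measure_Iic_eq_of_levelCrossing (hlam : 0 ≤ lam)
    (hlevel : ∀ x, 0 ≤ x → ν.real (Iic x) = ν.real (Iic 0) +
      ∫ y in (0 : ℝ)..x, lam * (ν.real (Iic y) - M.real (Iic y)))
    {x t : ℝ} (hx : 0 ≤ x) (ht : 0 ≤ t) :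
    ν (Iic x) = expTail lam t * ν (Iic (x + t)) +
      ∫⁻ s in Icc 0 t, ENNReal.ofReal lam * expTail lam s * M (Iic (x + s)) := by
  have hnonneg (s : ℝ) : 0 ≤ lam * Real.exp (-(lam * s)) * M.real (Iic (x + s)) := by positivity
  have hmono : Monotone fun s => M.real (Iic (x + s)) :=
    fun a b hab => monotone_measureReal_Iic M (by gcongr)
  have hint : IntervalIntegrable (fun s => lam * Real.exp (-(lam * s)) * M.real (Iic (x + s)))
      volume 0 t := hmono.intervalIntegrable.continuousOn_mul (by fun_prop)
  rw [← ofReal_measureReal, measureReal_Iic_eq_of_levelCrossing hlevel hx ht,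
    ENNReal.ofReal_add (by positivity) (intervalIntegral.integral_nonneg ht fun s _ => hnonneg s),
    ENNReal.ofReal_mul (Real.exp_pos _).le, ofReal_measureReal,
    intervalIntegral.integral_of_le ht, ← integral_Icc_eq_integral_Ioc,
    ofReal_integral_eq_lintegral_ofReal
      ((intervalIntegrable_iff_integrableOn_Icc_of_le ht).1 hint) (.of_forall hnonneg)]
  congr 1
  refine lintegral_congr fun s => ?_
  rw [ENNReal.ofReal_mul (by positivity), ENNReal.ofReal_mul hlam, ofReal_measureReal, expTail]

theorem eq_map_add_map_of_levelCrossing (hlam : 0 ≤ lam) (hν : ν (Iio 0) = 0)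
    (hlevel : ∀ x, 0 ≤ x → ν.real (Iic x) = ν.real (Iic 0) +
      ∫ y in (0 : ℝ)..x, lam * (ν.real (Iic y) - M.real (Iic y)))
    {t : ℝ} (ht : 0 ≤ t) :
    ν = expTail lam t • ν.map (fun x => max (x - t) 0) +
      (((volume.restrict (Icc 0 t)).withDensity
        fun s => ENNReal.ofReal lam * expTail lam s).prod M).map fun q => max (q.2 - q.1) 0 := by
  refine Measure.ext_of_Iic _ _ fun x => ?_
  rw [Measure.add_apply, Measure.smul_apply, smul_eq_mul,
    Measure.map_apply (by fun_prop) measurableSet_Iic,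
    Measure.map_apply (by fun_prop) measurableSet_Iic]
  rcases lt_or_ge x 0 with hx | hx
  · have hnever (s y : ℝ) : ¬ max (y - s) 0 ≤ x := fun h => hx.not_ge ((le_max_right _ _).trans h)
    simp [preimage, hnever, measure_mono_null (Iic_subset_Iio.2 hx) hν]
  · have hpreimage (s : ℝ) : (fun y => max (y - s) 0) ⁻¹' Iic x = Iic (x + s) := by
      ext y
      simp [hx]
    have hM : Measurable fun s => M (Iic (x + s)) :=
      Monotone.measurable fun a b hab => measure_mono (Iic_subset_Iic.2 (by gcongr))
    rw [Measure.prod_apply (measurableSet_Iic.preimage (by fun_prop)), hpreimage]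
    simp_rw [← preimage_comp, Function.comp_def, hpreimage]
    rw [lintegral_withDensity_eq_lintegral_mul _ (by fun_prop) hM]
    exact measure_Iic_eq_of_levelCrossing hlam hlevel hx ht

theorem lintegral_eq_of_levelCrossing (hlam : 0 ≤ lam) (hν : ν (Iio 0) = 0)
    (hlevel : ∀ x, 0 ≤ x → ν.real (Iic x) = ν.real (Iic 0) +
      ∫ y in (0 : ℝ)..x, lam * (ν.real (Iic y) - M.real (Iic y)))
    {t : ℝ} (ht : 0 ≤ t) {g : ℝ → ℝ≥0∞} (hg : Measurable g) :
    ∫⁻ x, g x ∂ν = expTail lam t * ∫⁻ x, g (max (x - t) 0) ∂ν +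
      ∫⁻ s in Icc 0 t, ENNReal.ofReal lam * expTail lam s * ∫⁻ x, g (max (x - s) 0) ∂M := by
  have hflow : Measurable fun q : ℝ × ℝ => g (max (q.2 - q.1) 0) := by fun_prop
  conv_lhs => rw [eq_map_add_map_of_levelCrossing hlam hν hlevel ht]
  rw [lintegral_add_measure, lintegral_smul_measure, smul_eq_mul, lintegral_map hg (by fun_prop),
    lintegral_map hg (by fun_prop), lintegral_prod _ hflow.aemeasurable,
    lintegral_withDensity_eq_lintegral_mul _ (by fun_prop) hflow.lintegral_prod_right']
  rfl

end levelCrossing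

/-! ### The workload just after an arrival -/

/-- The law of the workload just after an arrival which finds the workload distributed as `ν`. -/
noncomputable def arrivalMeasure (ν G : Measure ℝ) : Measure ℝ :=
  (ν.prod G).map fun q => min (q.1 + q.2) 1

instance (ν G : Measure ℝ) [IsFiniteMeasure ν] [IsFiniteMeasure G] :
    IsFiniteMeasure (arrivalMeasure ν G) := by
  unfold arrivalMeasure
  infer_instance

section arrivalMeasure

variable (ν : Measure ℝ) {G : Measure ℝ} [IsProbabilityMeasure G] {w : ℝ}

theorem lintegral_arrivalMeasure [SFinite ν] {g : ℝ → ℝ≥0∞} (hg : Measurable g) :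
    ∫⁻ x, g x ∂arrivalMeasure ν G = ∫⁻ x, ∫⁻ y, g (min (x + y) 1) ∂G ∂ν := by
  rw [arrivalMeasure, lintegral_map hg (by fun_prop), lintegral_prod _ (by fun_prop)]

theorem arrivalMeasure_real_Iic_of_one_le (hw : 1 ≤ w) :
    (arrivalMeasure ν G).real (Iic w) = ν.real univ := by
  have hpreimage : (fun q : ℝ × ℝ => min (q.1 + q.2) 1) ⁻¹' Iic w = univ ×ˢ univ := by
    rw [univ_prod_univ]
    exact eq_univ_of_forall fun q => (min_le_right _ _).trans hw
  rw [arrivalMeasure, map_measureReal_apply (by fun_prop) measurableSet_Iic, hpreimage,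
    measureReal_prod_prod, probReal_univ (μ := G), mul_one]

theorem integrable_cdf_const_sub (ν : Measure ℝ) [IsFiniteMeasure ν] (G : Measure ℝ) (w : ℝ) :
    Integrable (fun v => cdf G (w - v)) ν := by
  have hmeas : Measurable fun v => cdf G (w - v) :=
    (monotone_cdf G).measurable.comp (measurable_const.sub measurable_id)
  exact .of_bound hmeas.aestronglyMeasurable 1 (.of_forall fun v => by
    simpa [abs_of_nonneg (cdf_nonneg G _)] using cdf_le_one G (w - v))

theorem arrivalMeasure_real_Iic_of_lt_one [IsFiniteMeasure ν] (hw : w < 1) :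
    (arrivalMeasure ν G).real (Iic w) = ∫ v, cdf G (w - v) ∂ν := by
  have hsection (v : ℝ) :
      Prod.mk v ⁻¹' ((fun q : ℝ × ℝ => min (q.1 + q.2) 1) ⁻¹' Iic w) = Iic (w - v) := by
    ext y
    simp [hw.not_ge, le_sub_iff_add_le']
  rw [measureReal_def, arrivalMeasure, Measure.map_apply (by fun_prop) measurableSet_Iic,
    Measure.prod_apply (measurableSet_Iic.preimage (by fun_prop)),
    integral_eq_lintegral_of_nonneg_ae (.of_forall fun v => cdf_nonneg G _)
      (integrable_cdf_const_sub ν G w).aestronglyMeasurable]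
  simp_rw [hsection, ofReal_cdf]

theorem measureReal_Iic_sub_arrivalMeasure [IsFiniteMeasure ν] (hG : G (Iio 0) = 0) (hw : w < 1) :
    ν.real (Iic w) - (arrivalMeasure ν G).real (Iic w) = ∫ v in Iic w, tail G (w - v) ∂ν := by
  have hcdf : ∀ v ∉ Iic w, cdf G (w - v) = 0 := fun v hv => by
    rw [cdf_eq_real, measureReal_def, measure_mono_null (Iic_subset_Iio.2 ?_) hG,
      ENNReal.toReal_zero]
    exact sub_neg.2 (not_le.1 hv)
  rw [arrivalMeasure_real_Iic_of_lt_one ν hw,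
    ← setIntegral_eq_integral_of_forall_compl_eq_zero hcdf]
  simp only [tail]
  rw [integral_sub (integrable_const 1) (integrable_cdf_const_sub ν G w).restrict]
  simp

end arrivalMeasure

/-! ### The stationary distribution -/

/-- The measure with a unit atom at `0` and the density `u` (meant to be nonnegative, and zero on
the negative half line). Up to normalization the stationary distribution is of this form. -/
noncomputable def atomAddDensity (u : ℝ → ℝ) : Measure ℝ :=
  Measure.dirac 0 + volume.withDensity fun x => ENNReal.ofReal (u x)

section atomAddDensity

variable {u : ℝ → ℝ}

theorem isFiniteMeasure_atomAddDensity (hu : Integrable u) :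
    IsFiniteMeasure (atomAddDensity u) := by
  have := isFiniteMeasure_withDensity_ofReal hu.2
  unfold atomAddDensity
  infer_instance

theorem atomAddDensity_eq_zero {A : Set ℝ} (hA : MeasurableSet A) (hzero : 0 ∉ A)
    (hu : ∀ x ∈ A, u x = 0) : atomAddDensity u A = 0 := by
  rw [atomAddDensity, Measure.add_apply, Measure.dirac_apply' _ hA, indicator_of_notMem hzero,
    zero_add, withDensity_apply _ hA]
  exact setLIntegral_eq_zero hA fun x hx => by simp [hu x hx]

theorem setIntegral_Iic_atomAddDensity (hu : Measurable u) (hu_nonneg : 0 ≤ u)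
    (hu_neg : ∀ x < 0, u x = 0) {f : ℝ → ℝ} (hf : Integrable f (atomAddDensity u)) {w : ℝ}
    (hw : 0 ≤ w) :
    ∫ y in Iic w, f y ∂atomAddDensity u = f 0 + ∫ y in (0 : ℝ)..w, f y * u y := by
  have hdensity : ∫ y in Iic w, f y ∂volume.withDensity (fun x => ENNReal.ofReal (u x)) =
      ∫ y in (0 : ℝ)..w, f y * u y := by
    rw [setIntegral_withDensity_eq_setIntegral_toReal_smul (by fun_prop) (by simp) _
        measurableSet_Iic, intervalIntegral.integral_of_le hw, ← integral_Icc_eq_integral_Ioc,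
      setIntegral_eq_of_subset_of_forall_sdiff_eq_zero measurableSet_Iic
        (Icc_subset_Iic_self (a := 0))]
    · simp only [ENNReal.toReal_ofReal (hu_nonneg _), smul_eq_mul, mul_comm]
    · intro y hy
      rw [hu_neg y (not_le.1 fun h => hy.2 ⟨h, hy.1⟩), ENNReal.ofReal_zero, ENNReal.toReal_zero,
        zero_smul]
  rw [atomAddDensity] at hf ⊢
  rw [Measure.restrict_add, integral_add_measure hf.left_of_add_measure.restrict
    hf.right_of_add_measure.restrict, hdensity, restrict_dirac' measurableSet_Iic,
    if_pos (mem_Iic.2 hw), integral_dirac]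

theorem atomAddDensity_real_Iic (hu : Measurable u) (hu_int : Integrable u) (hu_nonneg : 0 ≤ u)
    (hu_neg : ∀ x < 0, u x = 0) {w : ℝ} (hw : 0 ≤ w) :
    (atomAddDensity u).real (Iic w) = 1 + ∫ y in (0 : ℝ)..w, u y := by
  have := isFiniteMeasure_atomAddDensity hu_int
  simpa using setIntegral_Iic_atomAddDensity hu hu_nonneg hu_neg (integrable_const 1) hw

end atomAddDensity

/-- The density series cut off at the capacity `1`: on `(0, ∞)`, the density of the stationary
distribution before normalization. -/
noncomputable def workloadDensity (lam : ℝ) (G : Measure ℝ) : ℝ → ℝ :=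
  (Ico 0 1).indicator (densitySeries lam G)

theorem measurable_workloadDensity (lam : ℝ) (G : Measure ℝ) :
    Measurable (workloadDensity lam G) :=
  (measurable_densitySeries lam G).indicator measurableSet_Ico

theorem integrable_workloadDensity (lam : ℝ) (G : Measure ℝ) :
    Integrable (workloadDensity lam G) :=
  ((intervalIntegrable_iff_integrableOn_Ico_of_le zero_le_one).1
    (intervalIntegrable_densitySeries lam G 1)).integrable_indicator measurableSet_Ico

theorem workloadDensity_nonneg {lam : ℝ} (hlam : 0 ≤ lam) (G : Measure ℝ) :
    0 ≤ workloadDensity lam G :=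
  indicator_nonneg fun _ hx => densitySeries_nonneg hlam G hx.1

theorem workloadDensity_of_notMem {lam : ℝ} {G : Measure ℝ} {x : ℝ} (hx : x ∉ Ico 0 1) :
    workloadDensity lam G x = 0 :=
  indicator_of_notMem hx _

theorem workloadDensity_ae_eq_on_Ioc (lam : ℝ) (G : Measure ℝ) :
    ∀ᵐ x, x ∈ Ioc (0 : ℝ) 1 → workloadDensity lam G x = densitySeries lam G x := by
  filter_upwards [Measure.ae_ne volume (1 : ℝ)] with x hx1 hx
  exact indicator_of_mem (mem_Ico.2 ⟨hx.1.le, hx.2.lt_of_ne hx1⟩) _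

theorem integral_workloadDensity (lam : ℝ) (G : Measure ℝ) {x : ℝ} (hx : x ∈ Icc (0 : ℝ) 1) :
    ∫ y in (0 : ℝ)..x, workloadDensity lam G y = integralSeries lam G x := by
  rw [integralSeries_eq]
  refine intervalIntegral.integral_congr_ae ?_
  filter_upwards [workloadDensity_ae_eq_on_Ioc lam G] with y hy hyx
  rw [uIoc_of_le hx.1] at hyx
  exact hy ⟨hyx.1, hyx.2.trans hx.2⟩

/-- The stationary distribution before normalization. -/
noncomputable def stationaryMeasure (lam : ℝ) (G : Measure ℝ) : Measure ℝ :=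
  atomAddDensity (workloadDensity lam G)

instance (lam : ℝ) (G : Measure ℝ) : IsFiniteMeasure (stationaryMeasure lam G) :=
  isFiniteMeasure_atomAddDensity (integrable_workloadDensity lam G)

theorem stationaryMeasure_compl_Icc (lam : ℝ) (G : Measure ℝ) :
    stationaryMeasure lam G (Icc 0 1)ᶜ = 0 :=
  atomAddDensity_eq_zero measurableSet_Icc.compl (by simp)
    fun _ hx => workloadDensity_of_notMem fun h => hx (Ico_subset_Icc_self h)

theorem stationaryMeasure_Iio_zero (lam : ℝ) (G : Measure ℝ) :
    stationaryMeasure lam G (Iio 0) = 0 :=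
  measure_mono_null (t := (Icc 0 1)ᶜ) (fun _ hx h => h.1.not_gt hx)
    (stationaryMeasure_compl_Icc lam G)

theorem stationaryMeasure_real_Iic_of_one_le (lam : ℝ) (G : Measure ℝ) {w : ℝ} (hw : 1 ≤ w) :
    (stationaryMeasure lam G).real (Iic w) = (stationaryMeasure lam G).real univ := by
  refine measureReal_congr (ae_eq_univ.2 ?_)
  exact measure_mono_null (t := (Icc 0 1)ᶜ) (fun _ hx h => hx (h.2.trans hw))
    (stationaryMeasure_compl_Icc lam G)

theorem stationaryMeasure_real_Iic {lam : ℝ} (hlam : 0 ≤ lam) (G : Measure ℝ) {w : ℝ}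
    (hw : 0 ≤ w) :
    (stationaryMeasure lam G).real (Iic w) = 1 + ∫ y in (0 : ℝ)..w, workloadDensity lam G y :=
  atomAddDensity_real_Iic (measurable_workloadDensity lam G) (integrable_workloadDensity lam G)
    (workloadDensity_nonneg hlam G) (fun _ hx => workloadDensity_of_notMem fun h => hx.not_ge h.1)
    hw

theorem stationaryMeasure_real_Icc {lam : ℝ} (hlam : 0 ≤ lam) (G : Measure ℝ) {x : ℝ}
    (hx : x ∈ Icc (0 : ℝ) 1) :
    (stationaryMeasure lam G).real (Icc 0 x) = 1 + integralSeries lam G x := by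
  rw [← integral_workloadDensity lam G hx, ← stationaryMeasure_real_Iic hlam G hx.1,
    ← Iic_sdiff_Iio, measureReal_sdiff_null (by simp [measureReal_def, stationaryMeasure_Iio_zero])]

theorem stationaryMeasure_real_univ {lam : ℝ} (hlam : 0 ≤ lam) (G : Measure ℝ) :
    (stationaryMeasure lam G).real univ = 1 + integralSeries lam G 1 := by
  rw [← stationaryMeasure_real_Iic_of_one_le lam G le_rfl,
    stationaryMeasure_real_Iic hlam G zero_le_one, integral_workloadDensity lam G (by simp)]

theorem stationaryMeasure_restrict_Ioc (lam : ℝ) (G : Measure ℝ) :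
    (stationaryMeasure lam G).restrict (Ioc 0 1) = (volume.restrict (Ioc 0 1)).withDensity
      fun x => ENNReal.ofReal (densitySeries lam G x) := by
  rw [stationaryMeasure, atomAddDensity, Measure.restrict_add, restrict_dirac' measurableSet_Ioc,
    if_neg (by simp), zero_add, restrict_withDensity measurableSet_Ioc]
  refine withDensity_congr_ae ((ae_restrict_iff' measurableSet_Ioc).2 ?_)
  filter_upwards [workloadDensity_ae_eq_on_Ioc lam G] with x hx hmem
  rw [hx hmem]

section invariance

variable {lam : ℝ} {G : Measure ℝ} [IsProbabilityMeasure G]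

/-- Below the capacity, the Volterra equation of the density series says that its value at `w` is
the rate `λ ∫ tail G (w - v) ∂ν` at which the workload jumps over the level `w`. -/
theorem workloadDensity_eq (hlam : 0 ≤ lam) (hG : G (Iio 0) = 0) {w : ℝ} (hw : 0 ≤ w) :
    workloadDensity lam G w = lam * ((stationaryMeasure lam G).real (Iic w) -
      (arrivalMeasure (stationaryMeasure lam G) G).real (Iic w)) := by
  rcases lt_or_ge w 1 with hw1 | hw1
  · have htail : Integrable (fun v => tail G (w - v)) (stationaryMeasure lam G) :=
      (integrable_const 1).sub (integrable_cdf_const_sub _ G w)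
    have hcut : ∫ y in (0 : ℝ)..w, tail G (w - y) * workloadDensity lam G y =
        ∫ y in (0 : ℝ)..w, tail G (w - y) * densitySeries lam G y := by
      refine intervalIntegral.integral_congr fun y hy => ?_
      rw [uIcc_of_le hw] at hy
      have hmem : y ∈ Ico (0 : ℝ) 1 := ⟨hy.1, hy.2.trans_lt hw1⟩
      simp only [workloadDensity, indicator_of_mem hmem]
    rw [measureReal_Iic_sub_arrivalMeasure _ hG hw1, stationaryMeasure,
      setIntegral_Iic_atomAddDensity (measurable_workloadDensity lam G)
        (workloadDensity_nonneg hlam G)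
        (fun _ hx => workloadDensity_of_notMem fun h => hx.not_ge h.1) htail hw,
      hcut, sub_zero, mul_add, ← densitySeries_eq]
    exact indicator_of_mem (mem_Ico.2 ⟨hw, hw1⟩) _
  · rw [arrivalMeasure_real_Iic_of_one_le _ hw1, stationaryMeasure_real_Iic_of_one_le lam G hw1,
      sub_self, mul_zero, workloadDensity_of_notMem fun h => h.2.not_ge hw1]

theorem stationaryMeasure_levelCrossing (hlam : 0 ≤ lam) (hG : G (Iio 0) = 0) {x : ℝ}
    (hx : 0 ≤ x) :
    (stationaryMeasure lam G).real (Iic x) = (stationaryMeasure lam G).real (Iic 0) +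
      ∫ y in (0 : ℝ)..x, lam * ((stationaryMeasure lam G).real (Iic y) -
        (arrivalMeasure (stationaryMeasure lam G) G).real (Iic y)) := by
  rw [stationaryMeasure_real_Iic hlam G hx, stationaryMeasure_real_Iic hlam G le_rfl,
    intervalIntegral.integral_same, add_zero]
  congr 1
  refine intervalIntegral.integral_congr fun y hy => ?_
  rw [uIcc_of_le hx] at hy
  exact workloadDensity_eq hlam hG hy.1

variable {Ω : Type*} [MeasurableSpace Ω] {P : Measure Ω} [IsProbabilityMeasure P]
  {I S : ℕ → Ω → ℝ}

theorem lintegral_transition_stationaryMeasure (hlam : 0 < lam) (hG : G (Iio 0) = 0)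
    (h : IsInput P lam G I S) {t : ℝ} (ht : 0 ≤ t) {A : Set ℝ} (hA : MeasurableSet A) :
    ∫⁻ x, transition P I S t x A ∂stationaryMeasure lam G = stationaryMeasure lam G A := by
  have hjump : Measurable fun q : (ℝ × ℝ) × ℝ =>
      transition P I S q.1.1 (min (q.1.2 + q.2) 1) A :=
    h.measurable_transition_comp hA (by fun_prop) (by fun_prop)
  rw [← lintegral_indicator_one hA]
  refine lintegral_eq_of_renewal_of_balance (M := arrivalMeasure (stationaryMeasure lam G) G)
    (φ := fun s x => max (x - s) 0) (c := ENNReal.ofReal lam)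
    (p := fun t x => transition P I S t x A)
    (k := fun t x => ∫⁻ y, transition P I S t (min (x + y) 1) A ∂G)
    (by fun_prop) (measurable_expTail lam) ENNReal.ofReal_ne_top (measurable_one.indicator hA)
    (hjump.lintegral_prod_right' (ν := G)) (fun t x => ?_)
    (fun t ht x => h.transition_eq hlam hA ht x)
    (fun t => lintegral_arrivalMeasure _
      (h.measurable_transition_comp hA measurable_const measurable_id))
    (fun t ht g hg => lintegral_eq_of_levelCrossing hlam.le (stationaryMeasure_Iio_zero lam G)
      (fun x hx => stationaryMeasure_levelCrossing hlam.le hG hx) ht hg) ht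
  calc ∫⁻ y, transition P I S t (min (x + y) 1) A ∂G ≤ ∫⁻ _, 1 ∂G :=
        lintegral_mono fun y => prob_le_one
    _ = 1 := by simp

end invariance

/-- The stationary distribution. -/
noncomputable def stationaryDistribution (lam : ℝ) (G : Measure ℝ) : Measure ℝ :=
  ENNReal.ofReal (1 / (1 + integralSeries lam G 1)) • stationaryMeasure lam G

theorem one_add_integralSeries_pos {lam : ℝ} (hlam : 0 ≤ lam) (G : Measure ℝ) :
    0 < 1 + integralSeries lam G 1 :=
  add_pos_of_pos_of_nonneg one_pos (integralSeries_nonneg hlam G zero_le_one)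

theorem isInvariantDistribution_stationaryDistribution {lam : ℝ} (hlam : 0 < lam) {G : Measure ℝ}
    [IsProbabilityMeasure G] (hG : G (Iio 0) = 0) {Ω : Type*} [MeasurableSpace Ω] {P : Measure Ω}
    [IsProbabilityMeasure P] {I S : ℕ → Ω → ℝ} (h : IsInput P lam G I S) :
    IsInvariantDistribution P I S (stationaryDistribution lam G) where
  isProbabilityMeasure := by
    have hmass := one_add_integralSeries_pos hlam.le G
    refine ⟨?_⟩
    rw [stationaryDistribution, Measure.smul_apply, smul_eq_mul, ← ofReal_measureReal,
      stationaryMeasure_real_univ hlam.le, ← ENNReal.ofReal_mul (by positivity),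
      one_div_mul_cancel hmass.ne', ENNReal.ofReal_one]
  supported := by
    rw [stationaryDistribution, Measure.smul_apply, stationaryMeasure_compl_Icc, smul_zero]
  invariant t ht A hA := by
    rw [stationaryDistribution, lintegral_smul_measure,
      lintegral_transition_stationaryMeasure hlam hG h ht hA, Measure.smul_apply]

theorem stationaryDistribution_restrict_Ioc {lam : ℝ} (hlam : 0 ≤ lam) (G : Measure ℝ) :
    (stationaryDistribution lam G).restrict (Ioc 0 1) =
      (volume.restrict (Ioc 0 1)).withDensity fun x =>
        ENNReal.ofReal (1 / (1 + integralSeries lam G 1) * densitySeries lam G x) := by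
  have hmass := one_add_integralSeries_pos hlam G
  rw [stationaryDistribution, Measure.restrict_smul, stationaryMeasure_restrict_Ioc,
    ← withDensity_smul _ (measurable_densitySeries lam G).ennreal_ofReal]
  congr 1 with x
  rw [Pi.smul_apply, smul_eq_mul, ← ENNReal.ofReal_mul (by positivity)]

theorem stationaryDistribution_real_Icc {lam : ℝ} (hlam : 0 ≤ lam) (G : Measure ℝ) {x : ℝ}
    (hx : x ∈ Icc (0 : ℝ) 1) :
    (stationaryDistribution lam G).real (Icc 0 x) =
      (1 + integralSeries lam G x) / (1 + integralSeries lam G 1) := by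
  have hmass := one_add_integralSeries_pos hlam G
  rw [stationaryDistribution, measureReal_ennreal_smul_apply, stationaryMeasure_real_Icc hlam G hx,
    ENNReal.toReal_ofReal (by positivity), one_div_mul_eq_div]

theorem stationaryDistribution_real_singleton_zero {lam : ℝ} (hlam : 0 ≤ lam) (G : Measure ℝ) :
    (stationaryDistribution lam G).real {0} = 1 / (1 + integralSeries lam G 1) := by
  rw [← Icc_self, stationaryDistribution_real_Icc hlam G (by simp), integralSeries_eq lam G 0,
    intervalIntegral.integral_same, add_zero]

end TruncatedQueue

open MeasureTheory Set TruncatedQueue in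
theorem theorem1 {Ω : Type*} [MeasurableSpace Ω] (P : Measure Ω) [IsProbabilityMeasure P]
    (lam : ℝ) (hlam : 0 < lam)
    (G : Measure ℝ) [IsProbabilityMeasure G] (hG : G (Iio 0) = 0)
    (I S : ℕ → Ω → ℝ) (hinput : IsInput P lam G I S) :
    -- the two series converge, and so do the integrals in them
    (∀ n : ℕ, IntervalIntegrable (convPow (tail G) n) volume 0 1) ∧
    (∀ x ∈ Icc (0 : ℝ) 1, Summable fun n : ℕ => lam ^ (n + 1) * convPow (tail G) n x) ∧
    (∀ x ∈ Icc (0 : ℝ) 1,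
      Summable fun n : ℕ => lam ^ (n + 1) * ∫ y in (0 : ℝ)..x, convPow (tail G) n y) ∧
    -- there is exactly one invariant distribution, and it is given by the formulas
    ∃ π : Measure ℝ, IsInvariantDistribution P I S π ∧
      (∀ π' : Measure ℝ, IsInvariantDistribution P I S π' → π' = π) ∧
      π.restrict (Ioc 0 1) = (volume.restrict (Ioc 0 1)).withDensity
        (fun x => ENNReal.ofReal (1 / (1 + integralSeries lam G 1) * densitySeries lam G x)) ∧
      (∀ x ∈ Icc (0 : ℝ) 1,
        π.real (Icc 0 x) = (1 + integralSeries lam G x) / (1 + integralSeries lam G 1)) ∧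
      0 < π.real {0} ∧ π.real {0} = 1 / (1 + integralSeries lam G 1) := by
  have hunique : ∀ π', IsInvariantDistribution P I S π' → π' = stationaryDistribution lam G :=
    fun _ hπ' => hπ'.eq hlam hinput (isInvariantDistribution_stationaryDistribution hlam hG hinput)
  refine ⟨fun n => intervalIntegrable_convPow (measurable_tail G) (abs_tail_le_one G) n 1,
    fun x _ => (hasSum_volterraResolvent (abs_tail_le_one G) lam x).summable,
    fun x _ => (hasSum_integralSeries lam G x).summable,
    stationaryDistribution lam G, isInvariantDistribution_stationaryDistribution hlam hG hinput,
    hunique, stationaryDistribution_restrict_Ioc hlam.le G,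
    fun x hx => stationaryDistribution_real_Icc hlam.le G hx, ?_,
    stationaryDistribution_real_singleton_zero hlam.le G⟩
  rw [stationaryDistribution_real_singleton_zero hlam.le]
  exact one_div_pos.2 (one_add_integralSeries_pos hlam.le G)
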